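/- Conventions. $\mathbb{F}_q$ is the finite field with $q$ elements. The subspace distance is $d_S(U,V)=\dim(U+V)-\dim(U\cap V)$. An $(n,d,\{k\})_q$ constant dimension code (CDC) is a non-empty set of $k$-dimensional subspaces of $\mathbb{F}_q^n$, any two distinct ones at subspace distance at least $d$; an $(n,M,d,\{k\})_q$ CDC is one with $M$ codewords. An $(n,d_1,d_0,T)_q$ mixed dimension/distance code (MDDC), where $d_1\ge d_0\ge 1$, is a set of subspaces of $\mathbb{F}_q^n$ in which the dimensions that occur are exactly the elements of $T$, distinct codewords of equal dimension have distance at least $d_1$, and codewords of different dimensions have distance at least $d_0$. An $(m\times n,d)_q$ rank-metric code is a set of matrices in $\mathbb{F}_q^{m\times n}$ whose pairwise differences have rank at least $d$; it is MRD if it has $q^{\max\{m,n\}(\min\{m,n\}-d+1)}$ elements, and it is an $(m\times n,d;r)_q$ rank-restricted code (RRMC) if all its elements have rank at most $r$. For a non-empty set $T$ of positive integers, $T^{\min}$ is its minimum, and $l_T=\min\{u-v:u,v\in T,\ u>v\}$ if $|T|>1$, $l_T=0$ if $|T|=1$. $\mathrm{rs}$ denotes the row space, RREF reduced row echelon form,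 $\mathrm{wt}$ and $d_H$ Hamming weight and distance, and $\mathbf{w}^{[i,j]}=(w_i,\dots,w_j)$. For $\mathbf{w}\in\mathbb{F}_2^n$ of weight $k$, let $p_1<\dots<p_k$ be the positions of its ones and $c_1<\dots<c_{n-k}$ the other positions. The Ferrers diagram $\mathcal{F}_{\mathbf{w}}$ of the echelon Ferrers form of $\mathbf{w}$, drawn inside a $k\times(n-k)$ array, has a dot in cell $(i,j)$ if and only if $p_i<c_j$. An $(\mathcal{F}_{\mathbf{w}},\delta;a,b,r)_q$ rank-restricted Ferrers diagram rank-metric code (RFDRMC) is a $(k\times(n-k),\delta)_q$ rank-metric code whose matrices vanish outside the dots of $\mathcal{F}_{\mathbf{w}}$ and whose submatrices formed by the top $a$ rows and the rightmost $b$ columns have rank at most $r$. Its lifted code $\mathscr{L}(\mathcal{C}_{\mathcal{F}_{\mathbf{w}}})$ consists of the $k$-dimensional subspaces of $\mathbb{F}_q^n$ whose RREF generator matrix has pivot columns $p_1,\dots,p_k$ and, once the pivot columns are deleted, carries at the dots of $\mathcal{F}_{\mathbf{w}}$ the entries of some $\mathbf{A}\in\mathcal{C}_{\mathcal{F}_{\mathbf{w}}}$.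 Mixed dimension construction. Let $n=n_1+n_2$, $n_1\ge k$, $n_2\ge k$, $k\ge\delta\ge 2$. Let $T_1\subseteq[\delta,k]$ and $T_2\subseteq[k+\delta-T_1^{\min},k]$ be non-empty sets of integers with $l_{T_1},l_{T_2}<2\delta$. For $i=1,2$ let $\mathcal{X}_i$ be an $(n_i,2\delta,2\delta-l_{T_i},T_i)_q$ MDDC and $\mathcal{H}_i$ the set of RREF generator matrices (of full row rank) of its codewords. For $t\in T_1$ let $\mathcal{P}_t$ be a $(k\times(n_2+t-k),\delta)_q$ MRD code, and for $s\in T_2$ let $\mathcal{Q}_s$ be a $(k\times(n_1+s-k),\delta;T_1^{\min}-\delta-(k-s))_q$ RRMC. Let $\mathcal{C}_1=\bigcup_{t\in T_1}\mathcal{C}_1^{(t)}$ and $\mathcal{C}_2=\bigcup_{s\in T_2}\mathcal{C}_2^{(s)}$, where $$\mathcal{C}_1^{(t)}=\left\{\mathrm{rs}\left(\begin{array}{c|cc}\begin{matrix}\mathbf{H}_1\\ \mathbf{O}\end{matrix}&\begin{matrix}\mathbf{O}\\ \mathbf{I}_{k-t}\end{matrix}&\mathbf{P}\end{array}\right):\mathbf{H}_1\in\mathcal{H}_1,\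 \mathrm{rank}(\mathbf{H}_1)=t,\ \mathbf{P}\in\mathcal{P}_t\right\},$$ $$\mathcal{C}_2^{(s)}=\left\{\mathrm{rs}\left(\begin{array}{cc|c}\mathbf{Q}&\begin{matrix}\mathbf{O}\\ \mathbf{I}_{k-s}\end{matrix}&\begin{matrix}\mathbf{H}_2\\ \mathbf{O}\end{matrix}\end{array}\right):\mathbf{Q}\in\mathcal{Q}_s,\ \mathbf{H}_2\in\mathcal{H}_2,\ \mathrm{rank}(\mathbf{H}_2)=s\right\}.$$ Theorem. Let $\mathcal{S}\subseteq\mathbb{F}_2^n$ be a set of vectors of Hamming weight $k$ such that $\mathrm{wt}(\mathbf{w}^{[1,n_1+T_2^{\min}-k]})\ge\delta$ and $\mathrm{wt}(\mathbf{w}^{[n_1+k-T_1^{\min}+1,n]})\ge\delta$ for all $\mathbf{w}\in\mathcal{S}$, and $d_H(\mathbf{w},\mathbf{w}')\ge 2\delta$ for all distinct $\mathbf{w},\mathbf{w}'\in\mathcal{S}$. For $\mathbf{w}\in\mathcal{S}$ put $r_{\mathbf{w}}=\mathrm{wt}(\mathbf{w}^{[1,n_1+T_2^{\min}-k]})$ and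 let $\mathcal{C}_{\mathcal{F}_{\mathbf{w}}}$ be an $(\mathcal{F}_{\mathbf{w}},\delta;r_{\mathbf{w}},n_2-T_2^{\min}+r_{\mathbf{w}},r_{\mathbf{w}}-\delta)_q$ RFDRMC. Let $\tilde{\mathcal{C}}_1=\bigcup_{\mathbf{w}\in\mathcal{S}}\mathscr{L}(\mathcal{C}_{\mathcal{F}_{\mathbf{w}}})$. Then $\tilde{\mathcal{C}}_1$ is an $(n,2\delta,\{k\})_q$ CDC, provided that $\mathcal{C}_{\mathcal{F}_{\mathbf{w}}}\neq\emptyset$ for at least one $\mathbf{w}\in\mathcal{S}$. Furthermore, $\mathcal{C}_1\cup\mathcal{C}_2\cup\tilde{\mathcal{C}}_1$ is an $(n,|\mathcal{C}_1|+|\mathcal{C}_2|+|\tilde{\mathcal{C}}_1|,2\delta,\{k\})_q$ CDC. -/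

import Mathlib

namespace SubspaceCodes

/-! ### Subspace codes -/

/-- The subspace distance `dim (U + V) - dim (U ∩ V)`. -/
noncomputable def subspaceDist {F : Type*} [Field F] {n : ℕ}
    (U V : Submodule F (Fin n → F)) : ℕ :=
  Module.finrank F ↥(U ⊔ V) - Module.finrank F ↥(U ⊓ V)

/-- The dimension distribution: `eta X i` is the number of `i`-dimensional members of `X`. -/
noncomputable def eta {F : Type*} [Field F] {n : ℕ}
    (X : Set (Submodule F (Fin n → F))) (i : ℕ) : ℕ :=
  {U ∈ X | Module.finrank F ↥U = i}.ncard

/-- `(n, d, T)_q` subspace codes over the finite field `F`: two distinct codewords have distance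
at least `d`, and `T` is exactly the set of the dimensions that occur. -/
structure IsSubspaceCode {F : Type*} [Field F] {n : ℕ}
    (d : ℕ) (T : Finset ℕ) (X : Set (Submodule F (Fin n → F))) : Prop where
  nonempty : X.Nonempty
  le_dist : ∀ U ∈ X, ∀ V ∈ X, U ≠ V → d ≤ subspaceDist U V
  eta_pos_iff : ∀ i, 0 < eta X i ↔ i ∈ T

/-- `(n, d, {k})_q` constant dimension codes. -/
def IsCDC {F : Type*} [Field F] {n : ℕ}
    (d k : ℕ) (X : Set (Submodule F (Fin n → F))) : Prop :=
  IsSubspaceCode d {k} X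

/-- `(n, d₁, d₀, T)_q` mixed dimension/distance codes. -/
structure IsMDDC {F : Type*} [Field F] {n : ℕ}
    (d₁ d₀ : ℕ) (T : Finset ℕ) (X : Set (Submodule F (Fin n → F))) : Prop where
  pos : 0 < d₀
  le : d₀ ≤ d₁
  le_dist_same : ∀ U ∈ X, ∀ V ∈ X, U ≠ V →
    Module.finrank F ↥U = Module.finrank F ↥V → d₁ ≤ subspaceDist U V
  le_dist_diff : ∀ U ∈ X, ∀ V ∈ X,
    Module.finrank F ↥U ≠ Module.finrank F ↥V → d₀ ≤ subspaceDist U V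
  eta_pos_iff : ∀ i, 0 < eta X i ↔ i ∈ T

/-- `l_T`: the least difference of two distinct elements of `T`, and `0` if `|T| = 1`. -/
noncomputable def minGap (T : Finset ℕ) : ℕ :=
  if 1 < T.card then sInf {d : ℕ | ∃ u ∈ T, ∃ v ∈ T, v < u ∧ d = u - v} else 0

/-! ### Reduced row echelon form and SC-representations -/

/-- The row space of a matrix. -/
def rowSpace {F : Type*} [Field F] {m n : ℕ} (M : Matrix (Fin m) (Fin n) F) :
    Submodule F (Fin n → F) :=
  Submodule.span F (Set.range M.row)

/-- `M` has full row rank and is in reduced row echelon form, and its `i`-th pivot is in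
column `p i`. -/
structure IsRREFWith {F : Type*} [Field F] {r n : ℕ}
    (p : Fin r ↪o Fin n) (M : Matrix (Fin r) (Fin n) F) : Prop where
  pivot : ∀ i, M i (p i) = 1
  left : ∀ i j, j < p i → M i j = 0
  column : ∀ i i', i' ≠ i → M i' (p i) = 0

/-- `H = ⋃_{r ∈ T} H r` is an SC-representation in reduced row echelon form of the code `X` with
dimensions in `T`: every member of `H r` has rank `r` and is in reduced row echelon form, distinct
members have distinct row spaces, and the row spaces of the members of `H r` are the codewords of
dimension `r`. -/
structure IsRREFSCRep {F : Type*} [Field F] {n : ℕ} (T : Finset ℕ)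
    (H : (r : ℕ) → Set (Matrix (Fin r) (Fin n) F)) (X : Set (Submodule F (Fin n → F))) :
    Prop where
  rank_eq : ∀ r ∈ T, ∀ A ∈ H r, A.rank = r
  rref : ∀ r ∈ T, ∀ A ∈ H r, ∃ p : Fin r ↪o Fin n, IsRREFWith p A
  injOn : ∀ r ∈ T, ∀ A ∈ H r, ∀ B ∈ H r, A ≠ B → rowSpace A ≠ rowSpace B
  image_eq : ∀ r ∈ T, {U ∈ X | Module.finrank F ↥U = r} = rowSpace '' H r

/-! ### Rank-metric codes -/

/-- `(m × n, d)_q` rank-metric codes. -/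
def IsRMC {F : Type*} [Field F] {m n : ℕ} (d : ℕ) (C : Set (Matrix (Fin m) (Fin n) F)) : Prop :=
  ∀ A ∈ C, ∀ B ∈ C, A ≠ B → d ≤ (A - B).rank

/-- `(m × n, d)_q` maximum rank distance codes: the rank-metric codes with
`q ^ (max m n * (min m n - d + 1))` codewords. -/
def IsMRD {F : Type*} [Field F] [Fintype F] {m n : ℕ} (d : ℕ)
    (C : Set (Matrix (Fin m) (Fin n) F)) : Prop :=
  IsRMC d C ∧ C.ncard = Fintype.card F ^ (max m n * (min m n + 1 - d))

/-- `(m × n, d; r)_q` rank-restricted rank-metric codes. -/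
def IsRRMC {F : Type*} [Field F] {m n : ℕ} (d r : ℕ)
    (C : Set (Matrix (Fin m) (Fin n) F)) : Prop :=
  IsRMC d C ∧ ∀ A ∈ C, A.rank ≤ r

/-- The submatrix formed by the top `a` rows and the rightmost `b` columns. -/
def topRight {F : Type*} {m n : ℕ} (a b : ℕ) (A : Matrix (Fin m) (Fin n) F) :
    Matrix {i : Fin m // (i : ℕ) < a} {j : Fin n // n ≤ (j : ℕ) + b} F :=
  A.submatrix Subtype.val Subtype.val

/-- `(D, d)_q` Ferrers diagram rank-metric codes, the diagram being given by its set `D` of dots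
in an `m × n` array. -/
def IsFDRMC {F : Type*} [Field F] {m n : ℕ} (D : Set (Fin m × Fin n)) (d : ℕ)
    (C : Set (Matrix (Fin m) (Fin n) F)) : Prop :=
  IsRMC d C ∧ ∀ A ∈ C, ∀ i j, (i, j) ∉ D → A i j = 0

/-- `(D, d; a, b, r)_q` rank-restricted Ferrers diagram rank-metric codes. -/
def IsRFDRMC {F : Type*} [Field F] {m n : ℕ} (D : Set (Fin m × Fin n)) (d a b r : ℕ)
    (C : Set (Matrix (Fin m) (Fin n) F)) : Prop :=
  IsFDRMC D d C ∧ ∀ A ∈ C, (topRight a b A).rank ≤ r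

/-! ### Identifying vectors, Ferrers diagrams and lifting -/

/-- The increasing enumeration of the non-pivot columns. -/
def nonPivots {k n : ℕ} (p : Fin k ↪o Fin n) : Fin (n - k) ↪o Fin n :=
  ((Finset.univ.map p.toEmbedding)ᶜ).orderEmbOfFin (by simp [Finset.card_compl])

/-- The Ferrers diagram of the echelon form with pivot columns `p`, as a set of dots in the
`k × (n - k)` array that is left after the pivot columns are removed: row `i` has dots exactly in
the non-pivot columns to the right of its pivot. (The dots are right-aligned as they stand; rows and
columns of the array that hold no dot are kept.) -/
def pivotDiagram {k n : ℕ} (p : Fin k ↪o Fin n) : Set (Fin k × Fin (n - k)) :=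
  {x | p x.1 < nonPivots p x.2}

/-- The positions of the ones of a binary vector of weight `k`, in increasing order: the pivot
columns of its echelon Ferrers form. -/
def pivotsOf {k n : ℕ} (w : Fin n → ZMod 2) (hw : hammingNorm w = k) : Fin k ↪o Fin n :=
  (Finset.univ.filter fun j => w j ≠ 0).orderEmbOfFin hw

/-- The Ferrers diagram of the echelon Ferrers form of a binary vector of weight `k`. -/
def ferrersDiagram {k n : ℕ} (w : Fin n → ZMod 2) (hw : hammingNorm w = k) :
    Set (Fin k × Fin (n - k)) :=
  pivotDiagram (pivotsOf w hw)

/-- The Ferrers tableaux form of the subspace whose reduced row echelon form is `M`, with pivot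
columns `p`: the entries of `M` at the dots of its Ferrers diagram, `none` elsewhere. -/
def tableau {F : Type*} {k n : ℕ} (p : Fin k ↪o Fin n) (M : Matrix (Fin k) (Fin n) F) :
    Fin k → Fin (n - k) → Option F :=
  fun i j => if p i < nonPivots p j then some (M i (nonPivots p j)) else none

open Classical in
/-- The portion of `A` at the dots of `D`. -/
noncomputable def portion {F : Type*} {m n : ℕ} (D : Set (Fin m × Fin n))
    (A : Matrix (Fin m) (Fin n) F) : Fin m → Fin n → Option F :=
  fun i j => if (i, j) ∈ D then some (A i j) else none

/-- The lifted Ferrers diagram rank-metric code: all `k`-dimensional subspaces whose Ferrers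
tableaux form is the portion at the dots of `D` of a codeword of `C`. (The matrix `M` is the unique
generator matrix of `X` in reduced row echelon form.) -/
def lifted {F : Type*} [Field F] {k n : ℕ} (D : Set (Fin k × Fin (n - k)))
    (C : Set (Matrix (Fin k) (Fin (n - k)) F)) : Set (Submodule F (Fin n → F)) :=
  {X | Module.finrank F ↥X = k ∧
    ∃ (p : Fin k ↪o Fin n) (M : Matrix (Fin k) (Fin n) F),
      IsRREFWith p M ∧ rowSpace M = X ∧ ∃ A ∈ C, tableau p M = portion D A}

/-- The weight of `w` in the positions `a + 1, …, b` (counted from `1`). -/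
def segWeight {n : ℕ} (w : Fin n → ZMod 2) (a b : ℕ) : ℕ :=
  (Finset.univ.filter fun j : Fin n => a ≤ (j : ℕ) ∧ (j : ℕ) < b ∧ w j ≠ 0).card

/-! ### The mixed dimension construction -/

/-- The `k × (n₁ + n₂)` matrix with column blocks of widths `n₁`, `k - t`, `n₂ + t - k`
(for `t ≤ k`)
`( H  O       | )`
`( O  I_{k-t} | P )`,
where `H` and the zero block to its right have `t` rows and `P` has `k` rows. -/
def blockLeft {F : Type*} [Field F] {k n₁ n₂ t : ℕ} (H : Matrix (Fin t) (Fin n₁) F)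
    (P : Matrix (Fin k) (Fin (n₂ + t - k)) F) : Matrix (Fin k) (Fin (n₁ + n₂)) F :=
  fun i j =>
    if hj : (j : ℕ) < n₁ then
      if hi : (i : ℕ) < t then H ⟨i, hi⟩ ⟨j, hj⟩ else 0
    else if hj' : (j : ℕ) < n₁ + (k - t) then
      if (i : ℕ) = t + (j - n₁) then 1 else 0
    else P i ⟨j - (n₁ + (k - t)), by omega⟩

/-- The `k × (n₁ + n₂)` matrix with column blocks of widths `n₁ + s - k`, `k - s`, `n₂`
(for `s ≤ k ≤ n₁ + s`)
`(   | O        H )`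
`( Q | I_{k-s}  O )`,
where `H` and the zero block to its left have `s` rows and `Q` has `k` rows. -/
def blockRight {F : Type*} [Field F] {k n₁ n₂ s : ℕ} (Q : Matrix (Fin k) (Fin (n₁ + s - k)) F)
    (H : Matrix (Fin s) (Fin n₂) F) : Matrix (Fin k) (Fin (n₁ + n₂)) F :=
  fun i j =>
    if hj : (j : ℕ) < n₁ + s - k then Q i ⟨j, hj⟩
    else if hj' : (j : ℕ) < n₁ then
      if (i : ℕ) = s + (j - (n₁ + s - k)) then 1 else 0
    else if hi : (i : ℕ) < s then H ⟨i, hi⟩ ⟨j - n₁, by omega⟩ else 0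

/-- The code `C₁ = ⋃_{t ∈ T₁} C₁^(t)` of the mixed dimension construction. -/
def mixedLeft {F : Type*} [Field F] (k n₁ n₂ : ℕ) (T : Finset ℕ)
    (H : (t : ℕ) → Set (Matrix (Fin t) (Fin n₁) F))
    (P : (t : ℕ) → Set (Matrix (Fin k) (Fin (n₂ + t - k)) F)) :
    Set (Submodule F (Fin (n₁ + n₂) → F)) :=
  {U | ∃ t ∈ T, ∃ A ∈ H t, ∃ B ∈ P t, U = rowSpace (blockLeft A B)}

/-- The code `C₂ = ⋃_{s ∈ T₂} C₂^(s)` of the mixed dimension construction. -/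
def mixedRight {F : Type*} [Field F] (k n₁ n₂ : ℕ) (T : Finset ℕ)
    (H : (s : ℕ) → Set (Matrix (Fin s) (Fin n₂) F))
    (Q : (s : ℕ) → Set (Matrix (Fin k) (Fin (n₁ + s - k)) F)) :
    Set (Submodule F (Fin (n₁ + n₂) → F)) :=
  {U | ∃ s ∈ T, ∃ B ∈ Q s, ∃ A ∈ H s, U = rowSpace (blockRight B A)}

/-- The union of the lifted codes `C w` over the identifying vectors `w ∈ S`. -/
def multilevel {F : Type*} [Field F] {k n : ℕ} (S : Set (Fin n → ZMod 2))
    (hS : ∀ w ∈ S, hammingNorm w = k)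
    (C : (Fin n → ZMod 2) → Set (Matrix (Fin k) (Fin (n - k)) F)) :
    Set (Submodule F (Fin n → F)) :=
  {X | ∃ (w : Fin n → ZMod 2) (hw : w ∈ S), X ∈ lifted (ferrersDiagram w (hS w hw)) (C w)}

end SubspaceCodes

open SubspaceCodes

open SubspaceCodes

namespace SubspaceCodes

/-! ### Ranks, row spaces and subspace distance under coordinate projections. -/

section LinearAlgebra

variable {F : Type*} [Field F]

/-! All codewords have dimension `k`, so distance at least `2δ` means an intersection of dimension
at most `k - δ`. For a linear map `f`, dim(U ∩ V) ≤ dim(fU ∩ fV) + dim U - dim fU. In particular U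
and V are far apart as soon as fU and fV differ in dimension by `δ`
(`two_mul_le_subspaceDist_of_map`). Each cross pair is handled by restricting to suitable columns.

`C₁` against `C₂`: on the first `n₁` columns the dimensions are `t ≥ T₁.min` and at most rank Q + (k
- s) ≤ T₁.min - δ. `C₁` against a lift: before column n₁ + k - T₁.min the former keeps dimension
`k`, while the lift loses its rows, at least `δ` of them, with pivots further right. `C₂` against a
lift: from column n₁ + T₂.min - k on the former keeps dimension `k`, while the `r_w` rows of the
lift with earlier pivots only have rank at most r_w - δ there, by the rank restriction.

Inside `C₁` and `C₂`, words with different H are separated by the mixed dimension code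
(`IsMDDC.two_mul_le_subspaceDist`); words with the same H, like lifts with the same identifying
vector, are separated by the rank metric (`FullOn.finrank_inf_add_rank_sub_le`). Lifts with
different identifying vectors meet in at most as many dimensions as they share pivots
(`IsRREFWith.finrank_inf_le_card`). Positive distances between the three codes make them disjoint,
so their sizes add up. -/

theorem finrank_inf_add_finrank_map_le {V W : Type*} [AddCommGroup V] [Module F V]
    [AddCommGroup W] [Module F W] [FiniteDimensional F V] (f : V →ₗ[F] W) (X Y : Submodule F V) :
    Module.finrank F ↥(X ⊓ Y) + Module.finrank F ↥(X.map f) ≤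
      Module.finrank F ↥(X.map f ⊓ Y.map f) + Module.finrank F ↥X := by
  -- Rank-nullity for `f` restricted to `Z`. The claim follows because the kernel on `X ⊓ Y` is no
  -- larger than the kernel on `X`.
  have h (Z : Submodule F V) : Module.finrank F ↥(Z.map f) + Module.finrank F ↥(Z ⊓ LinearMap.ker f)
      = Module.finrank F ↥Z := by
    have h1 := LinearMap.finrank_range_add_finrank_ker (f.domRestrict Z)
    rw [LinearMap.range_domRestrict] at h1
    have h2 : Module.finrank F ↥(LinearMap.ker (f.domRestrict Z)) =
        Module.finrank F ↥(Z ⊓ LinearMap.ker f) := by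
      rw [LinearMap.ker_domRestrict, ← Submodule.map_comap_subtype,
        Submodule.finrank_map_subtype_eq]
    omega
  have h1 := h (X ⊓ Y)
  have h2 := h X
  have h3 : Module.finrank F ↥((X ⊓ Y).map f) ≤ Module.finrank F ↥(X.map f ⊓ Y.map f) :=
    Submodule.finrank_mono (Submodule.map_inf_le f)
  have h4 : Module.finrank F ↥(X ⊓ Y ⊓ LinearMap.ker f) ≤
      Module.finrank F ↥(X ⊓ LinearMap.ker f) :=
    Submodule.finrank_mono (inf_le_inf_right _ inf_le_left)
  omega

theorem rank_le_rank_rows_add_card {m n : Type*} [Fintype m] [Fintype n]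
    (A : Matrix m n F) (p : m → Prop) [DecidablePred p] :
    A.rank ≤ (A.submatrix (Subtype.val : {i // p i} → m) id).rank +
      Fintype.card {i // ¬ p i} := by
  rw [Matrix.rank_eq_finrank_span_row, Matrix.rank_eq_finrank_span_row]
  have h : Submodule.span F (Set.range A.row) ≤
      Submodule.span F (Set.range (A.submatrix (Subtype.val : {i // p i} → m) id).row) ⊔
      Submodule.span F (Set.range (A.submatrix (Subtype.val : {i // ¬ p i} → m) id).row) := by
    rw [← Submodule.span_union, Submodule.span_le]
    rintro _ ⟨i, rfl⟩
    apply Submodule.subset_span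
    by_cases hi : p i
    · exact Or.inl ⟨⟨i, hi⟩, rfl⟩
    · exact Or.inr ⟨⟨i, hi⟩, rfl⟩
  refine (Submodule.finrank_mono h).trans ((Submodule.finrank_add_le_finrank_add_finrank _ _).trans ?_)
  exact Nat.add_le_add_left (finrank_range_le_card _) _

theorem rank_le_rank_cols_add_card {m n : Type*} [Fintype m] [Fintype n]
    (A : Matrix m n F) (p : n → Prop) [DecidablePred p] :
    A.rank ≤ (A.submatrix id (Subtype.val : {j // p j} → n)).rank +
      Fintype.card {j // ¬ p j} := by
  have h := rank_le_rank_rows_add_card A.transpose p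
  rwa [Matrix.rank_transpose, ← Matrix.rank_transpose (A.transpose.submatrix _ _)] at h

theorem rank_le_of_col_eq_zero_or {m n n' : Type*} [Fintype m] [Fintype n] [Fintype n']
    (A : Matrix m n F) (B : Matrix m n' F)
    (h : ∀ j, (∀ i, A i j = 0) ∨ ∃ j', ∀ i, A i j = B i j') : A.rank ≤ B.rank := by
  rw [Matrix.rank_eq_finrank_span_cols, Matrix.rank_eq_finrank_span_cols]
  apply Submodule.finrank_mono
  rw [Submodule.span_le]
  rintro _ ⟨j, rfl⟩
  rcases h j with h | ⟨j', h⟩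
  · rw [show A.col j = 0 from funext h]
    exact Submodule.zero_mem _
  · rw [show A.col j = B.col j' from funext h]
    exact Submodule.subset_span ⟨j', rfl⟩

theorem range_vecMulLinear_eq_rowSpace {m n : ℕ} (M : Matrix (Fin m) (Fin n) F) :
    LinearMap.range M.vecMulLinear = rowSpace M := by
  rw [rowSpace, range_vecMulLinear]

theorem mem_rowSpace {m n : ℕ} {M : Matrix (Fin m) (Fin n) F} {x : Fin n → F} :
    x ∈ rowSpace M ↔ ∃ c, Matrix.vecMul c M = x := by
  rw [← range_vecMulLinear_eq_rowSpace]
  rfl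

theorem finrank_rowSpace {m n : ℕ} (M : Matrix (Fin m) (Fin n) F) :
    Module.finrank F ↥(rowSpace M) = M.rank :=
  (Matrix.rank_eq_finrank_span_row M).symm

theorem finrank_map_funLeft_rowSpace {m n : ℕ} {l : Type*} [Fintype l]
    (M : Matrix (Fin m) (Fin n) F) (σ : l → Fin n) :
    Module.finrank F ↥((rowSpace M).map (LinearMap.funLeft F F σ)) =
      (M.submatrix id σ).rank := by
  rw [rowSpace, Submodule.map_span, Matrix.rank_eq_finrank_span_row, ← Set.range_comp]
  rfl

theorem eq_zero_of_vecMul_eq_zero_of_rank {m n : ℕ} {M : Matrix (Fin m) (Fin n) F}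
    (hM : M.rank = m) {c : Fin m → F} (hc : Matrix.vecMul c M = 0) : c = 0 := by
  have h : LinearIndependent F M.row := by
    rw [linearIndependent_iff_card_eq_finrank_span, Fintype.card_fin, Set.finrank,
      ← Matrix.rank_eq_finrank_span_row, hM]
  rw [← Matrix.vecMul_injective_iff] at h
  exact h (by simpa using hc)

/-- The rows of `M` stay linearly independent when only the columns in `J` are kept. -/
def FullOn {m n : ℕ} (M : Matrix (Fin m) (Fin n) F) (J : Set (Fin n)) : Prop :=
  ∀ c, (∀ j ∈ J, Matrix.vecMul c M j = 0) → c = 0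

theorem FullOn.mono {m n : ℕ} {M : Matrix (Fin m) (Fin n) F} {J J' : Set (Fin n)}
    (h : FullOn M J) (hJ : J ⊆ J') : FullOn M J' :=
  fun c hc => h c fun j hj => hc j (hJ hj)

theorem FullOn.finrank_map {m n : ℕ} {M : Matrix (Fin m) (Fin n) F} {J : Set (Fin n)}
    (h : FullOn M J) :
    Module.finrank F ↥((rowSpace M).map (LinearMap.funLeft F F (Subtype.val : J → Fin n))) = m := by
  classical
  rw [finrank_map_funLeft_rowSpace]
  have h : LinearIndependent F (M.submatrix id (Subtype.val : J → Fin n)).row := by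
    rw [← Matrix.vecMul_injective_iff]
    intro c d hcd
    refine sub_eq_zero.1 (h _ fun j hj => ?_)
    rw [Matrix.sub_vecMul, Pi.sub_apply, sub_eq_zero]
    exact congrFun hcd ⟨j, hj⟩
  rw [h.rank_matrix, Fintype.card_fin]

theorem FullOn.finrank_rowSpace {m n : ℕ} {M : Matrix (Fin m) (Fin n) F} {J : Set (Fin n)}
    (h : FullOn M J) : Module.finrank F ↥(rowSpace M) = m := by
  refine le_antisymm ?_ ?_
  · exact (finrank_range_le_card _).trans_eq (Fintype.card_fin _)
  · exact h.finrank_map.symm.trans_le (Submodule.finrank_map_le _ _)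

/-- The columns in `J` agree and determine the coefficients, so a common vector has the same
coefficient vector `c` in both matrices. Then `c` lies in the left kernel of `M - M'`, which has
dimension `m` minus the rank. -/
theorem FullOn.finrank_inf_add_rank_sub_le {m n : ℕ} {M M' : Matrix (Fin m) (Fin n) F}
    {J : Set (Fin n)} (h : FullOn M J) (hJ : ∀ i, ∀ j ∈ J, M i j = M' i j) :
    Module.finrank F ↥(rowSpace M ⊓ rowSpace M') + (M - M').rank ≤ m := by
  have hle : rowSpace M ⊓ rowSpace M' ≤
      (LinearMap.ker (M - M').vecMulLinear).map M.vecMulLinear := by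
    rintro x ⟨h1, h2⟩
    obtain ⟨c, hc⟩ := mem_rowSpace.1 h1
    obtain ⟨d, hd⟩ := mem_rowSpace.1 h2
    have hcd : c = d := by
      refine sub_eq_zero.1 (h _ fun j hj => ?_)
      rw [Matrix.sub_vecMul, Pi.sub_apply, sub_eq_zero, hc, ← hd]
      simp only [Matrix.vecMul, dotProduct]
      exact Finset.sum_congr rfl fun i _ => by rw [hJ i j hj]
    subst hcd
    refine ⟨c, ?_, hc⟩
    simp [hc, hd]
  have h1 := (Submodule.finrank_mono hle).trans (Submodule.finrank_map_le _ _)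
  have h2 := LinearMap.finrank_range_add_finrank_ker (M - M').vecMulLinear
  rw [range_vecMulLinear_eq_rowSpace, SubspaceCodes.finrank_rowSpace, Module.finrank_fin_fun] at h2
  omega

theorem subspaceDist_add_two_mul {n : ℕ} (U V : Submodule F (Fin n → F)) :
    subspaceDist U V + 2 * Module.finrank F ↥(U ⊓ V) =
      Module.finrank F ↥U + Module.finrank F ↥V := by
  have h1 := Submodule.finrank_sup_add_finrank_inf_eq U V
  have h2 : Module.finrank F ↥(U ⊓ V) ≤ Module.finrank F ↥(U ⊔ V) :=
    Submodule.finrank_mono (inf_le_left.trans le_sup_left)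
  unfold subspaceDist
  omega

theorem two_mul_le_subspaceDist {n k δ : ℕ} {U V : Submodule F (Fin n → F)}
    (hU : Module.finrank F ↥U = k) (hV : Module.finrank F ↥V = k)
    (h : Module.finrank F ↥(U ⊓ V) + δ ≤ k) : 2 * δ ≤ subspaceDist U V := by
  have := subspaceDist_add_two_mul U V
  omega

/-- Subspaces whose images under a linear map have dimensions that differ by `δ` are far apart. -/
theorem two_mul_le_subspaceDist_of_map {n k δ : ℕ} {W : Type*} [AddCommGroup W] [Module F W]
    [FiniteDimensional F W]
    {U V : Submodule F (Fin n → F)} (f : (Fin n → F) →ₗ[F] W)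
    (hU : Module.finrank F ↥U = k) (hV : Module.finrank F ↥V = k)
    (h : Module.finrank F ↥(V.map f) + δ ≤ Module.finrank F ↥(U.map f)) :
    2 * δ ≤ subspaceDist U V := by
  refine two_mul_le_subspaceDist hU hV ?_
  have h1 := finrank_inf_add_finrank_map_le f U V
  have h2 : Module.finrank F ↥(U.map f ⊓ V.map f) ≤ Module.finrank F ↥(V.map f) :=
    Submodule.finrank_mono inf_le_right
  omega

theorem subspaceDist_comm {n : ℕ} (U V : Submodule F (Fin n → F)) :
    subspaceDist U V = subspaceDist V U := by
  rw [subspaceDist, subspaceDist, sup_comm, inf_comm]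

theorem subspaceDist_self {n : ℕ} (U : Submodule F (Fin n → F)) : subspaceDist U U = 0 := by
  rw [subspaceDist, sup_idem, inf_idem, Nat.sub_self]

end LinearAlgebra

/-! ### Pivot positions, Ferrers diagrams and binary identifying vectors. -/

section Pivots

variable {k n : ℕ}

theorem range_nonPivots (p : Fin k ↪o Fin n) : Set.range (nonPivots p) = (Set.range p)ᶜ := by
  rw [nonPivots, Finset.range_orderEmbOfFin]
  simp

theorem nonPivots_ne (p : Fin k ↪o Fin n) (i : Fin k) (l : Fin (n - k)) : nonPivots p l ≠ p i := by
  intro h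
  have : nonPivots p l ∈ (Set.range p)ᶜ := by
    rw [← range_nonPivots]
    exact ⟨l, rfl⟩
  exact this ⟨i, h.symm⟩

theorem exists_pivot_or_nonPivot (p : Fin k ↪o Fin n) (j : Fin n) :
    (∃ i, p i = j) ∨ ∃ l, nonPivots p l = j := by
  by_cases h : j ∈ Set.range p
  · exact Or.inl h
  · right
    have : j ∈ (Set.range p)ᶜ := h
    rwa [← range_nonPivots] at this

theorem card_pivots_lt_add_card_nonPivots_lt (p : Fin k ↪o Fin n) {c : ℕ} (hc : c ≤ n) :
    (Finset.univ.filter fun i => (p i : ℕ) < c).card +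
      (Finset.univ.filter fun l => (nonPivots p l : ℕ) < c).card = c := by
  have h : (Finset.univ.filter fun j : Fin n => (j : ℕ) < c) =
      (Finset.univ.filter fun i => (p i : ℕ) < c).map p.toEmbedding ∪
      (Finset.univ.filter fun l => (nonPivots p l : ℕ) < c).map (nonPivots p).toEmbedding := by
    ext j
    simp only [Finset.mem_filter, Finset.mem_univ, true_and, Finset.mem_union, Finset.mem_map]
    constructor
    · intro hj
      rcases exists_pivot_or_nonPivot p j with ⟨i, rfl⟩ | ⟨l, rfl⟩
      · exact Or.inl ⟨i, hj, rfl⟩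
      · exact Or.inr ⟨l, hj, rfl⟩
    · rintro (⟨i, hi, rfl⟩ | ⟨l, hl, rfl⟩)
      · exact hi
      · exact hl
  have hd : Disjoint ((Finset.univ.filter fun i => (p i : ℕ) < c).map p.toEmbedding)
      ((Finset.univ.filter fun l => (nonPivots p l : ℕ) < c).map (nonPivots p).toEmbedding) := by
    rw [Finset.disjoint_left]
    intro j hj hj'
    obtain ⟨i, -, rfl⟩ := Finset.mem_map.1 hj
    obtain ⟨l, -, hl⟩ := Finset.mem_map.1 hj'
    exact nonPivots_ne p i l hl
  have h2 := congrArg Finset.card h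
  rw [Finset.card_union_of_disjoint hd, Finset.card_map, Finset.card_map,
    Fin.card_filter_val_lt, min_eq_right hc] at h2
  exact h2.symm

theorem card_filter_lt_of_orderEmb {m : ℕ} (p : Fin m ↪o Fin n) (i : Fin m) :
    (Finset.univ.filter fun i' => (p i' : ℕ) < p i).card = i := by
  have : (Finset.univ.filter fun i' => (p i' : ℕ) < p i) = Finset.Iio i := by
    ext i'
    simp
  rw [this, Fin.card_Iio]

/-- The columns before the pivot of row `i` are `i` pivots and the non-pivots whose cells in row `i`
carry no dot, so the diagram determines each pivot. This identifies the pivots that `lifted` leaves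
existentially quantified. -/
theorem eq_of_pivotDiagram_eq {p p' : Fin k ↪o Fin n} (h : pivotDiagram p = pivotDiagram p') :
    p = p' := by
  classical
  have key (q : Fin k ↪o Fin n) (i : Fin k) :
      (q i : ℕ) = i + (Finset.univ.filter fun l => (i, l) ∉ pivotDiagram q).card := by
    have h1 := card_pivots_lt_add_card_nonPivots_lt q (q i).isLt.le
    rw [card_filter_lt_of_orderEmb] at h1
    have h2 : (Finset.univ.filter fun l => (nonPivots q l : ℕ) < q i) =
        Finset.univ.filter fun l => (i, l) ∉ pivotDiagram q := by
      ext l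
      have := nonPivots_ne q i l
      simp only [pivotDiagram, Finset.mem_filter, Finset.mem_univ, true_and, Set.mem_ofPred_eq,
        not_lt]
      exact ⟨fun h => le_of_lt h, fun h => lt_of_le_of_ne h fun h' => this (Fin.ext h')⟩
    rw [← h2, h1]
  ext i
  rw [key p, key p', h]

/-- The rows whose pivots lie before column `c` come first. -/
theorem pivot_lt_of_lt_card (p : Fin k ↪o Fin n) {c : ℕ} {i : Fin k}
    (h : (i : ℕ) < (Finset.univ.filter fun i => (p i : ℕ) < c).card) : (p i : ℕ) < c := by
  by_contra! hc
  have hle : (Finset.univ.filter fun i => (p i : ℕ) < c).card ≤ (Finset.Iio i).card := by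
    refine Finset.card_le_card fun i' hi' => ?_
    have : (p i' : ℕ) < c := by simpa using hi'
    have : p i' < p i := Fin.lt_def.2 (by omega)
    simpa using this
  rw [Fin.card_Iio] at hle
  omega

/-- The non-pivots before column `c` are among the `l` non-pivots preceding the one with index `l`;
the remaining columns before `c` are pivots. -/
theorem le_add_card_of_le_nonPivots (p : Fin k ↪o Fin n) {c : ℕ} {l : Fin (n - k)}
    (h : c ≤ (nonPivots p l : ℕ)) :
    c ≤ l + (Finset.univ.filter fun i => (p i : ℕ) < c).card := by
  have h1 := card_pivots_lt_add_card_nonPivots_lt p (h.trans (nonPivots p l).isLt.le)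
  have h2 := card_filter_lt_of_orderEmb (nonPivots p) l
  have h3 : (Finset.univ.filter fun l => (nonPivots p l : ℕ) < c).card ≤
      (Finset.univ.filter fun l' => (nonPivots p l' : ℕ) < nonPivots p l).card := by
    refine Finset.card_le_card fun l' hl' => ?_
    simp only [Finset.mem_filter, Finset.mem_univ, true_and] at hl' ⊢
    omega
  omega

theorem range_pivotsOf (w : Fin n → ZMod 2) (hw : hammingNorm w = k) :
    Set.range (pivotsOf w hw) = {j | w j ≠ 0} := by
  refine (Finset.range_orderEmbOfFin _ hw).trans ?_
  simp

theorem pivotsOf_ne_zero (w : Fin n → ZMod 2) (hw : hammingNorm w = k) (i : Fin k) :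
    w (pivotsOf w hw i) ≠ 0 := by
  have : pivotsOf w hw i ∈ {j | w j ≠ 0} := by
    rw [← range_pivotsOf w hw]
    exact ⟨i, rfl⟩
  exact this

theorem segWeight_eq_card (w : Fin n → ZMod 2) (hw : hammingNorm w = k) (a b : ℕ) :
    segWeight w a b = (Finset.univ.filter fun i =>
      a ≤ (pivotsOf w hw i : ℕ) ∧ (pivotsOf w hw i : ℕ) < b).card := by
  rw [← Finset.card_map (pivotsOf w hw).toEmbedding, segWeight]
  congr 1
  ext j
  simp only [Finset.mem_filter, Finset.mem_univ, true_and, Finset.mem_map]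
  constructor
  · rintro ⟨h1, h2, h3⟩
    have : j ∈ Set.range (pivotsOf w hw) := by
      rw [range_pivotsOf]
      exact h3
    obtain ⟨i, rfl⟩ := this
    exact ⟨i, ⟨h1, h2⟩, rfl⟩
  · rintro ⟨i, ⟨h1, h2⟩, rfl⟩
    exact ⟨h1, h2, pivotsOf_ne_zero w hw i⟩

theorem hammingDist_add_two_mul_card (w w' : Fin n → ZMod 2) :
    hammingDist w w' + 2 * (Finset.univ.filter fun j => w j ≠ 0 ∧ w' j ≠ 0).card =
      hammingNorm w + hammingNorm w' := by
  simp only [hammingDist, hammingNorm, Finset.card_filter, Finset.mul_sum,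
    ← Finset.sum_add_distrib]
  refine Finset.sum_congr rfl fun j _ => ?_
  -- Two non-zero bits are equal, so a position where both words are non-zero adds nothing to the
  -- Hamming distance.
  have h : ∀ a b : ZMod 2, a ≠ 0 → b ≠ 0 → a = b := by decide
  have := h (w j) (w' j)
  split_ifs <;> simp_all

end Pivots

/-! ### Reduced row echelon matrices and lifted Ferrers diagram codes. -/

section Lifted

variable {F : Type*} [Field F] {k n : ℕ} {p : Fin k ↪o Fin n} {M : Matrix (Fin k) (Fin n) F}

theorem IsRREFWith.vecMul_pivot (h : IsRREFWith p M) (c : Fin k → F) (i : Fin k) :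
    Matrix.vecMul c M (p i) = c i := by
  rw [Matrix.vecMul, dotProduct, Finset.sum_eq_single i]
  · rw [h.pivot, mul_one]
  · intro i' _ hi'
    rw [h.column i i' hi', mul_zero]
  · simp

theorem IsRREFWith.fullOn (h : IsRREFWith p M) : FullOn M (Set.range p) := by
  intro c hc
  ext i
  rw [← h.vecMul_pivot c i]
  exact hc _ ⟨i, rfl⟩

/-- The leading position of a non-zero vector of the row space is a pivot. -/
theorem IsRREFWith.mem_range_of_leading (h : IsRREFWith p M) {x : Fin n → F}
    (hx : x ∈ rowSpace M) {j : Fin n} (hj : x j ≠ 0) (hlt : ∀ j' < j, x j' = 0) :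
    j ∈ Set.range p := by
  obtain ⟨c, rfl⟩ := mem_rowSpace.1 hx
  by_contra hr
  apply hj
  rw [Matrix.vecMul, dotProduct]
  -- Rows with an earlier pivot have coefficient zero, the coefficient being the entry of the vector
  -- at that pivot. Rows with a later pivot vanish in column `j`.
  refine Finset.sum_eq_zero fun i _ => ?_
  rcases lt_trichotomy (p i) j with hi | hi | hi
  · have := hlt _ hi
    rw [h.vecMul_pivot] at this
    rw [this, zero_mul]
  · exact absurd ⟨i, hi⟩ hr
  · rw [h.left i j hi, mul_zero]

/-- Restriction to the coordinates in `s` is injective on the intersection: the leading position of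
a non-zero common vector is a pivot of both matrices, hence lies in `s`. -/
theorem IsRREFWith.finrank_inf_le_card {p' : Fin k ↪o Fin n} {M' : Matrix (Fin k) (Fin n) F}
    (h : IsRREFWith p M) (h' : IsRREFWith p' M') (s : Finset (Fin n))
    (hs : ∀ j, j ∈ Set.range p → j ∈ Set.range p' → j ∈ s) :
    Module.finrank F ↥(rowSpace M ⊓ rowSpace M') ≤ s.card := by
  have hinj : Function.Injective ((LinearMap.funLeft F F (Subtype.val : s → Fin n)).domRestrict
      (rowSpace M ⊓ rowSpace M')) := by
    rw [← LinearMap.ker_eq_bot, LinearMap.ker_eq_bot']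
    rintro ⟨x, hx⟩ hx0
    by_contra hne
    have hne' : ∃ j, x j ≠ 0 := by
      by_contra! h0
      exact hne (Subtype.ext (funext h0))
    obtain ⟨j, hj, hmin⟩ := WellFounded.has_min (wellFounded_lt (α := Fin n)) {j | x j ≠ 0} hne'
    have hlt : ∀ j' < j, x j' = 0 := fun j' hj' => by
      by_contra h0
      exact hmin j' h0 hj'
    have hjs := hs j (h.mem_range_of_leading hx.1 hj hlt) (h'.mem_range_of_leading hx.2 hj hlt)
    exact hj (congrFun hx0 ⟨j, hjs⟩)
  have := LinearMap.finrank_le_finrank_of_injective hinj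
  simpa using this

/-- `M` is the matrix in reduced row echelon form with pivots `p` that carries `A` in the
remaining columns. -/
def IsLift (p : Fin k ↪o Fin n) (M : Matrix (Fin k) (Fin n) F)
    (A : Matrix (Fin k) (Fin (n - k)) F) : Prop :=
  IsRREFWith p M ∧ ∀ i l, M i (nonPivots p l) = A i l

theorem exists_isLift_of_mem_lifted {C : Set (Matrix (Fin k) (Fin (n - k)) F)}
    (hC : ∀ A ∈ C, ∀ i j, (i, j) ∉ pivotDiagram p → A i j = 0) {X : Submodule F (Fin n → F)}
    (hX : X ∈ lifted (pivotDiagram p) C) :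
    ∃ M, ∃ A ∈ C, IsLift p M A ∧ rowSpace M = X := by
  classical
  obtain ⟨-, p', M, hM, rfl, A, hA, ht⟩ := hX
  have ht' (i l) := congrFun (congrFun ht i) l
  simp only [tableau, portion] at ht'
  -- The pattern of `some` and `none` alone shows that the two diagrams coincide.
  have hp : p' = p := by
    refine eq_of_pivotDiagram_eq (Set.ext fun ⟨i, l⟩ => ?_)
    have := ht' i l
    change p' i < nonPivots p' l ↔ _
    split_ifs at this <;> simp_all
  subst hp
  refine ⟨M, A, hA, ⟨hM, fun i l => ?_⟩, rfl⟩
  have := ht' i l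
  by_cases h : p' i < nonPivots p' l
  · have h' : (i, l) ∈ pivotDiagram p' := h
    rw [if_pos h, if_pos h'] at this
    exact Option.some.inj this
  · rw [hC A hA i l h]
    exact hM.left i _ (lt_of_le_of_ne (not_lt.1 h) (nonPivots_ne p' i l))

theorem IsLift.finrank_rowSpace {A : Matrix (Fin k) (Fin (n - k)) F} (h : IsLift p M A) :
    Module.finrank F ↥(rowSpace M) = k :=
  h.1.fullOn.finrank_rowSpace

theorem IsLift.two_mul_le_subspaceDist {M' : Matrix (Fin k) (Fin n) F}
    {A A' : Matrix (Fin k) (Fin (n - k)) F} (h : IsLift p M A) (h' : IsLift p M' A') {δ : ℕ}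
    (hA : δ ≤ (A - A').rank) : 2 * δ ≤ subspaceDist (rowSpace M) (rowSpace M') := by
  refine SubspaceCodes.two_mul_le_subspaceDist h.finrank_rowSpace h'.finrank_rowSpace ?_
  have h1 := h.1.fullOn.finrank_inf_add_rank_sub_le (M' := M') (by
    rintro i _ ⟨i', rfl⟩
    rcases eq_or_ne i i' with rfl | hi
    · rw [h.1.pivot, h'.1.pivot]
    · rw [h.1.column _ _ hi, h'.1.column _ _ hi])
  have h2 : (A - A').rank ≤ (M - M').rank := by
    refine rank_le_of_col_eq_zero_or _ _ fun l => Or.inr ⟨nonPivots p l, fun i => ?_⟩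
    simp [h.2, h'.2]
  omega

/-- In the columns before `c`, only the rows with pivots before `c` are non-zero. -/
theorem IsRREFWith.finrank_map_add_card_le (h : IsRREFWith p M) (c : ℕ) :
    Module.finrank F ↥((rowSpace M).map
        (LinearMap.funLeft F F (Subtype.val : {j : Fin n | (j : ℕ) < c} → Fin n))) +
      (Finset.univ.filter fun i => c ≤ (p i : ℕ)).card ≤ k := by
  rw [finrank_map_funLeft_rowSpace]
  have h1 := rank_le_rank_rows_add_card
    (M.submatrix id (Subtype.val : {j : Fin n | (j : ℕ) < c} → Fin n)) fun i => c ≤ (p i : ℕ)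
  have h0 : ((M.submatrix id (Subtype.val : {j : Fin n | (j : ℕ) < c} → Fin n)).submatrix
      (Subtype.val : {i // c ≤ (p i : ℕ)} → Fin k) id) = 0 := by
    ext ⟨i, hi⟩ ⟨j, hj⟩
    have hj : (j : ℕ) < c := hj
    exact h.left i j (Fin.lt_def.2 (by omega))
  rw [h0, Matrix.rank_zero, zero_add, Fintype.card_subtype] at h1
  have h2 := Finset.card_filter_add_card_filter_not (s := Finset.univ)
    (fun i : Fin k => c ≤ (p i : ℕ))
  rw [Finset.card_univ, Fintype.card_fin] at h2
  omega

/-- The columns from `c` on of a lifted matrix, in terms of a top right submatrix of the matrix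
that is lifted. -/
theorem IsLift.finrank_map_le {A : Matrix (Fin k) (Fin (n - k)) F} (h : IsLift p M A) {a b c : ℕ}
    (ha : a = (Finset.univ.filter fun i => (p i : ℕ) < c).card) (hb : n - k ≤ c - a + b) :
    Module.finrank F ↥((rowSpace M).map
        (LinearMap.funLeft F F (Subtype.val : {j : Fin n | c ≤ (j : ℕ)} → Fin n))) + a ≤
      (topRight a b A).rank + k := by
  rw [finrank_map_funLeft_rowSpace]
  have h1 := rank_le_rank_rows_add_card
    (M.submatrix id (Subtype.val : {j : Fin n | c ≤ (j : ℕ)} → Fin n)) fun i => (i : ℕ) < a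
  have h2 : ((M.submatrix id (Subtype.val : {j : Fin n | c ≤ (j : ℕ)} → Fin n)).submatrix
      (Subtype.val : {i : Fin k // (i : ℕ) < a} → Fin k) id).rank ≤ (topRight a b A).rank := by
    refine rank_le_of_col_eq_zero_or _ _ ?_
    rintro ⟨j, hj⟩
    have hj : c ≤ (j : ℕ) := hj
    rcases exists_pivot_or_nonPivot p j with ⟨i', rfl⟩ | ⟨l, rfl⟩
    -- A pivot column at or after `c` belongs to a row outside the top `a`, so it vanishes in the
    -- top rows.
    · refine Or.inl ?_
      rintro ⟨i, hi⟩
      refine h.1.column i' i ?_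
      rintro rfl
      have := pivot_lt_of_lt_card p (ha ▸ hi)
      omega
    -- The index of this non-pivot is at least `c - a`, which by `hb` puts it among the rightmost
    -- `b`.
    · have hl := le_add_card_of_le_nonPivots p hj
      refine Or.inr ⟨⟨l, by omega⟩, ?_⟩
      rintro ⟨i, hi⟩
      exact h.2 i l
  have h3 : a ≤ k := by
    rw [ha]
    exact (Finset.card_le_univ _).trans_eq (Fintype.card_fin k)
  have h4 : Fintype.card {i : Fin k // ¬ (i : ℕ) < a} = k - a := by
    rw [Fintype.card_subtype_compl, Fintype.card_subtype, Fin.card_filter_val_lt, Fintype.card_fin,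
      min_eq_right h3]
  omega

end Lifted

/-! ### The block matrices that generate `C₁` and `C₂`. -/

section Blocks

variable {F : Type*} [Field F] {k n₁ n₂ t : ℕ}

theorem sum_fin_eq_sum_castLE {k t : ℕ} (h : t ≤ k) (f : Fin k → F)
    (hf : ∀ i : Fin k, t ≤ (i : ℕ) → f i = 0) : ∑ i, f i = ∑ i : Fin t, f (Fin.castLE h i) := by
  obtain ⟨d, rfl⟩ := Nat.exists_eq_add_of_le h
  rw [Fin.sum_univ_add, Finset.sum_eq_zero fun i _ => hf (Fin.natAdd t i) (Nat.le_add_right _ _),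
    add_zero]
  rfl

theorem blockLeft_castAdd (A : Matrix (Fin t) (Fin n₁) F) (B : Matrix (Fin k) (Fin (n₂ + t - k)) F)
    (i : Fin k) (j : Fin n₁) :
    blockLeft A B i (Fin.castAdd n₂ j) = if hi : (i : ℕ) < t then A ⟨i, hi⟩ j else 0 := by
  simp [blockLeft]

theorem blockLeft_mid (A : Matrix (Fin t) (Fin n₁) F) (B : Matrix (Fin k) (Fin (n₂ + t - k)) F)
    (i : Fin k) {j : Fin (n₁ + n₂)} (h1 : n₁ ≤ (j : ℕ)) (h2 : (j : ℕ) < n₁ + (k - t)) :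
    blockLeft A B i j = if (i : ℕ) = t + (j - n₁) then 1 else 0 := by
  rw [blockLeft, dif_neg (by omega), dif_pos h2]

theorem blockLeft_right (A : Matrix (Fin t) (Fin n₁) F) (B : Matrix (Fin k) (Fin (n₂ + t - k)) F)
    (i : Fin k) (l : Fin (n₂ + t - k)) (h : n₁ + (k - t) + (l : ℕ) < n₁ + n₂) :
    blockLeft A B i ⟨n₁ + (k - t) + l, h⟩ = B i l := by
  rw [blockLeft, dif_neg (by dsimp only; omega), dif_neg (by dsimp only; omega)]
  congr 1
  ext
  simp

theorem blockLeft_eq_of_lt (A : Matrix (Fin t) (Fin n₁) F)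
    (B B' : Matrix (Fin k) (Fin (n₂ + t - k)) F) (i : Fin k) {j : Fin (n₁ + n₂)}
    (h : (j : ℕ) < n₁ + (k - t)) : blockLeft A B i j = blockLeft A B' i j := by
  unfold blockLeft
  split_ifs <;> rfl

theorem map_rowSpace_blockLeft (htk : t ≤ k) (A : Matrix (Fin t) (Fin n₁) F)
    (B : Matrix (Fin k) (Fin (n₂ + t - k)) F) :
    (rowSpace (blockLeft A B)).map (LinearMap.funLeft F F (Fin.castAdd n₂)) = rowSpace A := by
  rw [rowSpace, Submodule.map_span, ← Set.range_comp]
  have h (i : Fin k) : (LinearMap.funLeft F F (Fin.castAdd n₂) ∘ (blockLeft A B).row) i =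
      if hi : (i : ℕ) < t then A ⟨i, hi⟩ else 0 := by
    ext j
    refine (blockLeft_castAdd A B i j).trans ?_
    split_ifs <;> rfl
  refine le_antisymm (Submodule.span_le.2 ?_) (Submodule.span_le.2 ?_)
  · rintro _ ⟨i, rfl⟩
    rw [h]
    split_ifs with hi
    · exact Submodule.subset_span ⟨⟨i, hi⟩, rfl⟩
    · exact Submodule.zero_mem _
  · rintro _ ⟨i, rfl⟩
    refine Submodule.subset_span ⟨Fin.castLE htk i, ?_⟩
    exact (h _).trans (dif_pos i.isLt)

/-- The identity block forces the last `k - t` coefficients to vanish; the others then vanish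
because `A` has independent rows. -/
theorem fullOn_blockLeft (htk : t ≤ k) (hkn₂ : k ≤ n₂) {A : Matrix (Fin t) (Fin n₁) F}
    (hA : A.rank = t) (B : Matrix (Fin k) (Fin (n₂ + t - k)) F) :
    FullOn (blockLeft A B) {j | (j : ℕ) < n₁ + (k - t)} := by
  intro c hc
  have h1 (i : Fin k) (hi : t ≤ (i : ℕ)) : c i = 0 := by
    -- This is the column of the identity block whose 1 stands in row `i`.
    have hj : n₁ + (i - t) < n₁ + n₂ := by omega
    rw [← hc ⟨n₁ + (i - t), hj⟩ (show n₁ + (i - t) < n₁ + (k - t) by omega), Matrix.vecMul,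
      dotProduct, Finset.sum_eq_single i]
    · rw [blockLeft_mid _ _ _ (by simp) (by dsimp only; omega), if_pos (by dsimp only; omega),
        mul_one]
    · intro i' _ hi'
      rw [blockLeft_mid _ _ _ (by simp) (by dsimp only; omega), if_neg, mul_zero]
      have := Fin.val_ne_of_ne hi'
      dsimp only
      omega
    · simp
  have h2 : (fun i : Fin t => c (Fin.castLE htk i)) = 0 := by
    refine eq_zero_of_vecMul_eq_zero_of_rank hA (funext fun j => ?_)
    rw [Pi.zero_apply, ← hc (Fin.castAdd n₂ j) (show (j : ℕ) < n₁ + (k - t) by omega),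
      Matrix.vecMul, Matrix.vecMul, dotProduct, dotProduct, sum_fin_eq_sum_castLE htk]
    · refine Finset.sum_congr rfl fun i _ => ?_
      have hi : (Fin.castLE htk i : ℕ) < t := i.isLt
      rw [blockLeft_castAdd, dif_pos hi]
      rfl
    · intro i hi
      rw [h1 i hi, zero_mul]
  ext i
  by_cases hi : (i : ℕ) < t
  · exact congrFun h2 ⟨i, hi⟩
  · exact h1 i (not_lt.1 hi)

theorem rank_sub_le_rank_blockLeft_sub (htk : t ≤ k) (A : Matrix (Fin t) (Fin n₁) F)
    (B B' : Matrix (Fin k) (Fin (n₂ + t - k)) F) :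
    (B - B').rank ≤ (blockLeft A B - blockLeft A B').rank := by
  refine rank_le_of_col_eq_zero_or _ _ fun l =>
    Or.inr ⟨⟨n₁ + (k - t) + l, by omega⟩, fun i => ?_⟩
  rw [Matrix.sub_apply, Matrix.sub_apply, blockLeft_right, blockLeft_right]

theorem blockRight_natAdd (Q : Matrix (Fin k) (Fin (n₁ + t - k)) F) (A : Matrix (Fin t) (Fin n₂) F)
    (htk : t ≤ k) (i : Fin k) (j : Fin n₂) :
    blockRight Q A i (Fin.natAdd n₁ j) = if hi : (i : ℕ) < t then A ⟨i, hi⟩ j else 0 := by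
  rw [blockRight, dif_neg (by simp; omega), dif_neg (by simp)]
  simp

theorem blockRight_mid (Q : Matrix (Fin k) (Fin (n₁ + t - k)) F) (A : Matrix (Fin t) (Fin n₂) F)
    (i : Fin k) {j : Fin (n₁ + n₂)} (h1 : n₁ + t - k ≤ (j : ℕ)) (h2 : (j : ℕ) < n₁) :
    blockRight Q A i j = if (i : ℕ) = t + (j - (n₁ + t - k)) then 1 else 0 := by
  rw [blockRight, dif_neg (by omega), dif_pos h2]

theorem blockRight_left (Q : Matrix (Fin k) (Fin (n₁ + t - k)) F) (A : Matrix (Fin t) (Fin n₂) F)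
    (i : Fin k) {j : Fin (n₁ + n₂)} (h : (j : ℕ) < n₁ + t - k) :
    blockRight Q A i j = Q i ⟨j, h⟩ := by
  rw [blockRight, dif_pos h]

theorem blockRight_eq_of_le (Q Q' : Matrix (Fin k) (Fin (n₁ + t - k)) F)
    (A : Matrix (Fin t) (Fin n₂) F) (i : Fin k) {j : Fin (n₁ + n₂)}
    (h : n₁ + t - k ≤ (j : ℕ)) : blockRight Q A i j = blockRight Q' A i j := by
  simp only [blockRight, dif_neg (not_lt.2 h)]

theorem map_rowSpace_blockRight (htk : t ≤ k) (Q : Matrix (Fin k) (Fin (n₁ + t - k)) F)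
    (A : Matrix (Fin t) (Fin n₂) F) :
    (rowSpace (blockRight Q A)).map (LinearMap.funLeft F F (Fin.natAdd n₁)) = rowSpace A := by
  rw [rowSpace, Submodule.map_span, ← Set.range_comp]
  have h (i : Fin k) : (LinearMap.funLeft F F (Fin.natAdd n₁) ∘ (blockRight Q A).row) i =
      if hi : (i : ℕ) < t then A ⟨i, hi⟩ else 0 := by
    ext j
    refine (blockRight_natAdd Q A htk i j).trans ?_
    split_ifs <;> rfl
  refine le_antisymm (Submodule.span_le.2 ?_) (Submodule.span_le.2 ?_)
  · rintro _ ⟨i, rfl⟩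
    rw [h]
    split_ifs with hi
    · exact Submodule.subset_span ⟨⟨i, hi⟩, rfl⟩
    · exact Submodule.zero_mem _
  · rintro _ ⟨i, rfl⟩
    refine Submodule.subset_span ⟨Fin.castLE htk i, ?_⟩
    exact (h _).trans (dif_pos i.isLt)

theorem fullOn_blockRight (htk : t ≤ k) (hkn₁ : k ≤ n₁) (Q : Matrix (Fin k) (Fin (n₁ + t - k)) F)
    {A : Matrix (Fin t) (Fin n₂) F} (hA : A.rank = t) :
    FullOn (blockRight Q A) {j | n₁ + t - k ≤ (j : ℕ)} := by
  intro c hc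
  have h1 (i : Fin k) (hi : t ≤ (i : ℕ)) : c i = 0 := by
    have hj : n₁ + t - k + (i - t) < n₁ + n₂ := by omega
    rw [← hc ⟨n₁ + t - k + (i - t), hj⟩ (show n₁ + t - k ≤ n₁ + t - k + (i - t) by omega),
      Matrix.vecMul, dotProduct, Finset.sum_eq_single i]
    · rw [blockRight_mid _ _ _ (by simp) (by dsimp only; omega), if_pos (by dsimp only; omega),
        mul_one]
    · intro i' _ hi'
      rw [blockRight_mid _ _ _ (by simp) (by dsimp only; omega), if_neg, mul_zero]
      have := Fin.val_ne_of_ne hi'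
      dsimp only
      omega
    · simp
  have h2 : (fun i : Fin t => c (Fin.castLE htk i)) = 0 := by
    refine eq_zero_of_vecMul_eq_zero_of_rank hA (funext fun j => ?_)
    rw [Pi.zero_apply, ← hc (Fin.natAdd n₁ j) (show n₁ + t - k ≤ n₁ + (j : ℕ) by omega),
      Matrix.vecMul, Matrix.vecMul, dotProduct, dotProduct, sum_fin_eq_sum_castLE htk]
    · refine Finset.sum_congr rfl fun i _ => ?_
      have hi : (Fin.castLE htk i : ℕ) < t := i.isLt
      rw [blockRight_natAdd _ _ htk, dif_pos hi]
      rfl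
    · intro i hi
      rw [h1 i hi, zero_mul]
  ext i
  by_cases hi : (i : ℕ) < t
  · exact congrFun h2 ⟨i, hi⟩
  · exact h1 i (not_lt.1 hi)

theorem rank_sub_le_rank_blockRight_sub (htk : t ≤ k) (Q Q' : Matrix (Fin k) (Fin (n₁ + t - k)) F)
    (A : Matrix (Fin t) (Fin n₂) F) :
    (Q - Q').rank ≤ (blockRight Q A - blockRight Q' A).rank := by
  refine rank_le_of_col_eq_zero_or _ _ fun l => Or.inr ⟨⟨l, by omega⟩, fun i => ?_⟩
  rw [Matrix.sub_apply, Matrix.sub_apply, blockRight_left _ _ _ l.isLt,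
    blockRight_left _ _ _ l.isLt]

/-- Besides the columns of `Q`, the first `n₁` columns contain only the `k - t` columns of the
identity block. -/
theorem finrank_map_castAdd_blockRight_le (htk : t ≤ k) (hkn₁ : k ≤ n₁)
    (Q : Matrix (Fin k) (Fin (n₁ + t - k)) F) (A : Matrix (Fin t) (Fin n₂) F) :
    Module.finrank F ↥((rowSpace (blockRight Q A)).map
      (LinearMap.funLeft F F (Fin.castAdd n₂))) ≤ Q.rank + (k - t) := by
  rw [finrank_map_funLeft_rowSpace]
  refine (rank_le_rank_cols_add_card _ fun j : Fin n₁ => (j : ℕ) < n₁ + t - k).trans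
    (Nat.add_le_add ?_ ?_)
  · refine rank_le_of_col_eq_zero_or _ _ ?_
    rintro ⟨j, hj⟩
    exact Or.inr ⟨⟨j, hj⟩, fun i => blockRight_left Q A i (j := Fin.castAdd n₂ j) hj⟩
  · rw [Fintype.card_subtype_compl, Fintype.card_subtype, Fin.card_filter_val_lt, Fintype.card_fin]
    omega

end Blocks

/-! ### Distances within and between `C₁`, `C₂` and the lifts. -/

section Codes

variable {F : Type*} [Field F]

theorem minGap_le_sub {T : Finset ℕ} {u v : ℕ} (hu : u ∈ T) (hv : v ∈ T) (h : v < u) :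
    minGap T ≤ u - v := by
  unfold minGap
  rw [if_pos (Finset.one_lt_card.2 ⟨u, hu, v, hv, h.ne'⟩)]
  exact Nat.sInf_le ⟨u, hu, v, hv, h, rfl⟩

/-- Subspaces that project onto distinct codewords of a mixed dimension/distance code. -/
theorem IsMDDC.two_mul_le_subspaceDist {n m k δ : ℕ} {T : Finset ℕ}
    {X : Set (Submodule F (Fin m → F))} (hX : IsMDDC (2 * δ) (2 * δ - minGap T) T X)
    {U V : Submodule F (Fin n → F)} (f : (Fin n → F) →ₗ[F] (Fin m → F))
    (hU : Module.finrank F ↥U = k) (hV : Module.finrank F ↥V = k)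
    (hfU : U.map f ∈ X) (hfV : V.map f ∈ X) (hTU : Module.finrank F ↥(U.map f) ∈ T)
    (hTV : Module.finrank F ↥(V.map f) ∈ T) (hne : U.map f ≠ V.map f) :
    2 * δ ≤ subspaceDist U V := by
  -- The larger image gives the stronger bound on the intersection.
  wlog hle : Module.finrank F ↥(V.map f) ≤ Module.finrank F ↥(U.map f) generalizing U V
  · rw [subspaceDist_comm]
    exact this hV hU hfV hfU hTV hTU hne.symm (not_le.1 hle).le
  refine SubspaceCodes.two_mul_le_subspaceDist hU hV ?_
  have h1 := finrank_inf_add_finrank_map_le f U V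
  have h2 := subspaceDist_add_two_mul (U.map f) (V.map f)
  rcases hle.eq_or_lt with h | h
  · have := hX.le_dist_same _ hfU _ hfV hne h.symm
    omega
  -- The bound involves half of the image distance plus the dimension difference. That difference is
  -- at least `minGap T`, which makes up for the weaker distance `2 * δ - minGap T`.
  · have h3 := hX.le_dist_diff _ hfU _ hfV h.ne'
    have h4 := minGap_le_sub hTU hTV h
    omega

theorem IsRREFSCRep.rowSpace_mem {n : ℕ} {T : Finset ℕ} {H : (r : ℕ) → Set (Matrix (Fin r) (Fin n) F)}
    {X : Set (Submodule F (Fin n → F))} (hH : IsRREFSCRep T H X) {t : ℕ} (ht : t ∈ T)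
    {A : Matrix (Fin t) (Fin n) F} (hA : A ∈ H t) : rowSpace A ∈ X := by
  have h : rowSpace A ∈ {U ∈ X | Module.finrank F ↥U = t} := by
    rw [hH.image_eq t ht]
    exact ⟨A, hA, rfl⟩
  exact h.1

theorem IsRREFSCRep.finrank_rowSpace {n : ℕ} {T : Finset ℕ}
    {H : (r : ℕ) → Set (Matrix (Fin r) (Fin n) F)}
    {X : Set (Submodule F (Fin n → F))} (hH : IsRREFSCRep T H X) {t : ℕ} (ht : t ∈ T)
    {A : Matrix (Fin t) (Fin n) F} (hA : A ∈ H t) : Module.finrank F ↥(rowSpace A) = t := by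
  rw [SubspaceCodes.finrank_rowSpace, hH.rank_eq t ht A hA]

theorem IsRREFSCRep.nonempty {n : ℕ} {T : Finset ℕ}
    {H : (r : ℕ) → Set (Matrix (Fin r) (Fin n) F)}
    {X : Set (Submodule F (Fin n → F))} (hH : IsRREFSCRep T H X) {t : ℕ} (ht : t ∈ T)
    (hX : 0 < eta X t) : (H t).Nonempty := by
  rw [eta, hH.image_eq t ht] at hX
  exact Set.image_nonempty.1 (Set.nonempty_of_ncard_ne_zero hX.ne')

variable {k n₁ n₂ δ : ℕ} {T : Finset ℕ}

/-- Projection to the first `n₁` columns recovers the codeword of `X`. If these differ, the code `X`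
separates the two words; if not, the representing matrix is the same and the rank distance of `P t`
does. -/
theorem two_mul_le_subspaceDist_blockLeft (hkn₂ : k ≤ n₂) (hT : ∀ t ∈ T, t ≤ k)
    {X : Set (Submodule F (Fin n₁ → F))} (hX : IsMDDC (2 * δ) (2 * δ - minGap T) T X)
    {H : (r : ℕ) → Set (Matrix (Fin r) (Fin n₁) F)} (hH : IsRREFSCRep T H X)
    {P : (t : ℕ) → Set (Matrix (Fin k) (Fin (n₂ + t - k)) F)} (hP : ∀ t ∈ T, IsRMC δ (P t))
    {U V : Submodule F (Fin (n₁ + n₂) → F)}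
    (hU : U ∈ mixedLeft k n₁ n₂ T H P) (hV : V ∈ mixedLeft k n₁ n₂ T H P) (hUV : U ≠ V) :
    2 * δ ≤ subspaceDist U V := by
  obtain ⟨t, ht, A, hA, B, hB, rfl⟩ := hU
  obtain ⟨t', ht', A', hA', B', hB', rfl⟩ := hV
  have hf := fullOn_blockLeft (hT t ht) hkn₂ (hH.rank_eq t ht A hA) B
  have hf' := fullOn_blockLeft (hT t' ht') hkn₂ (hH.rank_eq t' ht' A' hA') B'
  have hm := map_rowSpace_blockLeft (n₂ := n₂) (hT t ht) A B
  have hm' := map_rowSpace_blockLeft (n₂ := n₂) (hT t' ht') A' B'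
  by_cases hne : rowSpace A = rowSpace A'
  · have htt : t = t' := by
      rw [← hH.finrank_rowSpace ht hA, hne, hH.finrank_rowSpace ht' hA']
    subst htt
    have hAA : A = A' := by
      by_contra h
      exact hH.injOn t ht A hA A' hA' h hne
    subst hAA
    have h1 := hf.finrank_inf_add_rank_sub_le fun i j hj => blockLeft_eq_of_lt A B B' i hj
    have h2 := rank_sub_le_rank_blockLeft_sub (n₂ := n₂) (hT t ht) A B B'
    have h3 := hP t ht B hB B' hB' (by
      rintro rfl
      exact hUV rfl)
    exact two_mul_le_subspaceDist hf.finrank_rowSpace hf'.finrank_rowSpace (by omega)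
  · refine hX.two_mul_le_subspaceDist (LinearMap.funLeft F F (Fin.castAdd n₂))
      hf.finrank_rowSpace hf'.finrank_rowSpace ?_ ?_ ?_ ?_ ?_
    · exact hm ▸ hH.rowSpace_mem ht hA
    · exact hm' ▸ hH.rowSpace_mem ht' hA'
    · rwa [hm, hH.finrank_rowSpace ht hA]
    · rwa [hm', hH.finrank_rowSpace ht' hA']
    · rwa [hm, hm']

theorem two_mul_le_subspaceDist_blockRight (hkn₁ : k ≤ n₁) (hT : ∀ t ∈ T, t ≤ k)
    {X : Set (Submodule F (Fin n₂ → F))} (hX : IsMDDC (2 * δ) (2 * δ - minGap T) T X)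
    {H : (r : ℕ) → Set (Matrix (Fin r) (Fin n₂) F)} (hH : IsRREFSCRep T H X)
    {Q : (t : ℕ) → Set (Matrix (Fin k) (Fin (n₁ + t - k)) F)} (hQ : ∀ t ∈ T, IsRMC δ (Q t))
    {U V : Submodule F (Fin (n₁ + n₂) → F)}
    (hU : U ∈ mixedRight k n₁ n₂ T H Q) (hV : V ∈ mixedRight k n₁ n₂ T H Q) (hUV : U ≠ V) :
    2 * δ ≤ subspaceDist U V := by
  obtain ⟨t, ht, B, hB, A, hA, rfl⟩ := hU
  obtain ⟨t', ht', B', hB', A', hA', rfl⟩ := hV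
  have hf := fullOn_blockRight (hT t ht) hkn₁ B (hH.rank_eq t ht A hA)
  have hf' := fullOn_blockRight (hT t' ht') hkn₁ B' (hH.rank_eq t' ht' A' hA')
  have hm := map_rowSpace_blockRight (n₁ := n₁) (hT t ht) B A
  have hm' := map_rowSpace_blockRight (n₁ := n₁) (hT t' ht') B' A'
  by_cases hne : rowSpace A = rowSpace A'
  · have htt : t = t' := by
      rw [← hH.finrank_rowSpace ht hA, hne, hH.finrank_rowSpace ht' hA']
    subst htt
    have hAA : A = A' := by
      by_contra h
      exact hH.injOn t ht A hA A' hA' h hne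
    subst hAA
    have h1 := hf.finrank_inf_add_rank_sub_le fun i j hj => blockRight_eq_of_le B B' A i hj
    have h2 := rank_sub_le_rank_blockRight_sub (n₁ := n₁) (hT t ht) B B' A
    have h3 := hQ t ht B hB B' hB' (by
      rintro rfl
      exact hUV rfl)
    exact two_mul_le_subspaceDist hf.finrank_rowSpace hf'.finrank_rowSpace (by omega)
  · refine hX.two_mul_le_subspaceDist (LinearMap.funLeft F F (Fin.natAdd n₁))
      hf.finrank_rowSpace hf'.finrank_rowSpace ?_ ?_ ?_ ?_ ?_
    · exact hm ▸ hH.rowSpace_mem ht hA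
    · exact hm' ▸ hH.rowSpace_mem ht' hA'
    · rwa [hm, hH.finrank_rowSpace ht hA]
    · rwa [hm', hH.finrank_rowSpace ht' hA']
    · rwa [hm, hm']

theorem two_mul_le_subspaceDist_blockLeft_blockRight {t s τ : ℕ} (hkn₁ : k ≤ n₁) (hkn₂ : k ≤ n₂)
    (hτ : τ ≤ t) (htk : t ≤ k) (hs : k + δ ≤ s + τ) (hsk : s ≤ k)
    {A : Matrix (Fin t) (Fin n₁) F} (hA : A.rank = t) (B : Matrix (Fin k) (Fin (n₂ + t - k)) F)
    {Q : Matrix (Fin k) (Fin (n₁ + s - k)) F} (hQ : Q.rank ≤ τ - δ - (k - s))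
    {A' : Matrix (Fin s) (Fin n₂) F} (hA' : A'.rank = s) :
    2 * δ ≤ subspaceDist (rowSpace (blockLeft A B)) (rowSpace (blockRight Q A')) := by
  have h1 := finrank_map_castAdd_blockRight_le hsk hkn₁ Q A'
  refine two_mul_le_subspaceDist_of_map (LinearMap.funLeft F F (Fin.castAdd n₂))
    (fullOn_blockLeft htk hkn₂ hA B).finrank_rowSpace
    (fullOn_blockRight hsk hkn₁ Q hA').finrank_rowSpace ?_
  rw [map_rowSpace_blockLeft htk, finrank_rowSpace, hA]
  -- By `hs` the subtraction in `hQ` is not truncated, so the image on the right has dimension at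
  -- most `τ - δ`.
  omega

/-- The cut at `n₁ + k - τ` serves every `t ≥ τ`, since it leaves H and the whole identity block on
its left. -/
theorem two_mul_le_subspaceDist_blockLeft_lift {t τ : ℕ} (hkn₂ : k ≤ n₂)
    (hτ : τ ≤ t) (htk : t ≤ k) {A : Matrix (Fin t) (Fin n₁) F} (hA : A.rank = t)
    (B : Matrix (Fin k) (Fin (n₂ + t - k)) F) {p : Fin k ↪o Fin (n₁ + n₂)}
    {M : Matrix (Fin k) (Fin (n₁ + n₂)) F} (hM : IsRREFWith p M)
    (hδ : δ ≤ (Finset.univ.filter fun i => n₁ + k - τ ≤ (p i : ℕ)).card) :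
    2 * δ ≤ subspaceDist (rowSpace (blockLeft A B)) (rowSpace M) := by
  have hf := fullOn_blockLeft htk hkn₂ hA B
  have h1 := hM.finrank_map_add_card_le (n₁ + k - τ)
  refine two_mul_le_subspaceDist_of_map
    (LinearMap.funLeft F F (Subtype.val : {j : Fin (n₁ + n₂) | (j : ℕ) < n₁ + k - τ} → _))
    hf.finrank_rowSpace hM.fullOn.finrank_rowSpace ?_
  have h2 : FullOn (blockLeft A B) {j | (j : ℕ) < n₁ + k - τ} :=
    hf.mono fun j (hj : (j : ℕ) < n₁ + (k - t)) => show (j : ℕ) < n₁ + k - τ by omega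
  rw [h2.finrank_map]
  omega

theorem two_mul_le_subspaceDist_blockRight_lift {s σ a : ℕ} (hkn₁ : k ≤ n₁) (hkn₂ : k ≤ n₂)
    (hσ : σ ≤ s) (hsk : s ≤ k) (Q : Matrix (Fin k) (Fin (n₁ + s - k)) F)
    {A : Matrix (Fin s) (Fin n₂) F} (hA : A.rank = s) {p : Fin k ↪o Fin (n₁ + n₂)}
    {M : Matrix (Fin k) (Fin (n₁ + n₂)) F} {B : Matrix (Fin k) (Fin (n₁ + n₂ - k)) F}
    (hM : IsLift p M B) (ha : a = (Finset.univ.filter fun i => (p i : ℕ) < n₁ + σ - k).card)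
    (hδ : δ ≤ a) (hB : (topRight a (n₂ - σ + a) B).rank ≤ a - δ) :
    2 * δ ≤ subspaceDist (rowSpace (blockRight Q A)) (rowSpace M) := by
  have hf := fullOn_blockRight hsk hkn₁ Q hA
  -- With this, `(n₁ + σ - k) - a + (n₂ - σ + a)` is exactly `n₁ + n₂ - k` in natural numbers, as
  -- `finrank_map_le` needs.
  have hac : a ≤ n₁ + σ - k := by
    have := card_pivots_lt_add_card_nonPivots_lt p (c := n₁ + σ - k) (by omega)
    omega
  have h1 := hM.finrank_map_le ha (b := n₂ - σ + a) (by omega)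
  refine two_mul_le_subspaceDist_of_map
    (LinearMap.funLeft F F (Subtype.val : {j : Fin (n₁ + n₂) | n₁ + σ - k ≤ (j : ℕ)} → _))
    hf.finrank_rowSpace hM.finrank_rowSpace ?_
  have h2 : FullOn (blockRight Q A) {j | n₁ + σ - k ≤ (j : ℕ)} :=
    hf.mono fun j (hj : n₁ + s - k ≤ (j : ℕ)) => show n₁ + σ - k ≤ (j : ℕ) by omega
  rw [h2.finrank_map]
  omega

theorem isCDC_of_forall [Finite F] {n d k : ℕ} {X : Set (Submodule F (Fin n → F))}
    (hne : X.Nonempty) (hk : ∀ U ∈ X, Module.finrank F ↥U = k)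
    (hd : ∀ U ∈ X, ∀ V ∈ X, U ≠ V → d ≤ subspaceDist U V) : IsCDC d k X := by
  refine ⟨hne, hd, fun i => ?_⟩
  -- Finiteness of `F` matters here: `ncard` of an infinite set would be 0.
  rw [eta, Set.ncard_pos, Finset.mem_singleton]
  constructor
  · rintro ⟨U, hU, rfl⟩
    exact hk U hU
  · rintro rfl
    obtain ⟨U, hU⟩ := hne
    exact ⟨U, hU, hk U hU⟩

theorem IsMRD.nonempty [Fintype F] {m n d : ℕ} {C : Set (Matrix (Fin m) (Fin n) F)}
    (hC : IsMRD d C) : C.Nonempty := by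
  refine Set.nonempty_of_ncard_ne_zero ?_
  rw [hC.2]
  exact pow_ne_zero _ Fintype.card_ne_zero

end Codes

/-! ### The union of the lifted codes over the identifying vectors. -/

section Multilevel

variable {F : Type*} [Field F] {k n δ : ℕ} {S : Set (Fin n → ZMod 2)}
  {hS : ∀ w ∈ S, hammingNorm w = k} {C : (Fin n → ZMod 2) → Set (Matrix (Fin k) (Fin (n - k)) F)}

theorem exists_isLift_of_mem_multilevel
    (hC : ∀ (w : Fin n → ZMod 2) (hw : w ∈ S), IsFDRMC (ferrersDiagram w (hS w hw)) δ (C w))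
    {X : Submodule F (Fin n → F)} (hX : X ∈ multilevel S hS C) :
    ∃ (w : Fin n → ZMod 2) (hw : w ∈ S), ∃ M, ∃ A ∈ C w,
      IsLift (pivotsOf w (hS w hw)) M A ∧ rowSpace M = X := by
  obtain ⟨w, hw, hX⟩ := hX
  obtain ⟨M, A, hA, hM, rfl⟩ := exists_isLift_of_mem_lifted (hC w hw).2 hX
  exact ⟨w, hw, M, A, hA, hM, rfl⟩

/-- Equal identifying vectors leave the rank distance of `C w`. Different ones of weight `k` share
`k` minus half their Hamming distance pivots, hence at most `k - δ`. -/
theorem two_mul_le_subspaceDist_multilevel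
    (hdist : ∀ w ∈ S, ∀ w' ∈ S, w ≠ w' → 2 * δ ≤ hammingDist w w')
    (hC : ∀ (w : Fin n → ZMod 2) (hw : w ∈ S), IsFDRMC (ferrersDiagram w (hS w hw)) δ (C w))
    {U V : Submodule F (Fin n → F)} (hU : U ∈ multilevel S hS C) (hV : V ∈ multilevel S hS C)
    (hUV : U ≠ V) : 2 * δ ≤ subspaceDist U V := by
  obtain ⟨w, hw, M, A, hA, hM, rfl⟩ := exists_isLift_of_mem_multilevel hC hU
  obtain ⟨w', hw', M', A', hA', hM', rfl⟩ := exists_isLift_of_mem_multilevel hC hV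
  rcases eq_or_ne w w' with rfl | hne
  · refine hM.two_mul_le_subspaceDist hM' ((hC w hw).1 A hA A' hA' ?_)
    rintro rfl
    refine hUV (congrArg rowSpace (Matrix.ext fun i j => ?_))
    rcases exists_pivot_or_nonPivot (pivotsOf w (hS w hw)) j with ⟨i', rfl⟩ | ⟨l, rfl⟩
    · rcases eq_or_ne i i' with rfl | hi
      · rw [hM.1.pivot, hM'.1.pivot]
      · rw [hM.1.column _ _ hi, hM'.1.column _ _ hi]
    · rw [hM.2, hM'.2]
  · refine two_mul_le_subspaceDist hM.finrank_rowSpace hM'.finrank_rowSpace ?_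
    have h1 := hM.1.finrank_inf_le_card hM'.1
      (Finset.univ.filter fun j => w j ≠ 0 ∧ w' j ≠ 0) (by
        rintro _ ⟨i, rfl⟩ ⟨i', hi'⟩
        simp only [Finset.mem_filter, Finset.mem_univ, true_and]
        exact ⟨pivotsOf_ne_zero w _ i, hi' ▸ pivotsOf_ne_zero w' _ i'⟩)
    have h2 := hammingDist_add_two_mul_card w w'
    have h3 := hdist w hw w' hw' hne
    rw [hS w hw, hS w' hw'] at h2
    omega

/-- The lift of every codeword of a Ferrers diagram code belongs to the multilevel code. -/
theorem multilevel_nonempty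
    (hC : ∀ (w : Fin n → ZMod 2) (hw : w ∈ S), IsFDRMC (ferrersDiagram w (hS w hw)) δ (C w))
    {w : Fin n → ZMod 2} (hw : w ∈ S) (hne : (C w).Nonempty) :
    (multilevel S hS C).Nonempty := by
  classical
  obtain ⟨A, hA⟩ := hne
  let p := pivotsOf w (hS w hw)
  -- The matrix is chosen column by column: unit vectors at the pivots, columns of `A` elsewhere.
  have hchoice : ∀ j : Fin n, ∃ v : Fin k → F,
      (∀ i, p i = j → v = Pi.single i 1) ∧ ∀ l, nonPivots p l = j → v = fun i => A i l := by
    intro j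
    rcases exists_pivot_or_nonPivot p j with ⟨i, rfl⟩ | ⟨l, rfl⟩
    · exact ⟨Pi.single i 1, fun i' h => by rw [p.injective h],
        fun l h => absurd h (nonPivots_ne p i l)⟩
    · exact ⟨fun i => A i l, fun i h => absurd h.symm (nonPivots_ne p i l),
        fun l' h => by rw [(nonPivots p).injective h]⟩
  choose v hv hv' using hchoice
  have hM : IsRREFWith p (Matrix.of fun i j => v j i) := by
    refine ⟨fun i => ?_, fun i j hj => ?_, fun i i' hi => ?_⟩
    · simp [hv _ i rfl]
    · rcases exists_pivot_or_nonPivot p j with ⟨i', rfl⟩ | ⟨l, rfl⟩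
      · have : i ≠ i' := by
          rintro rfl
          exact lt_irrefl _ hj
        simp [hv _ i' rfl, this]
      · rw [Matrix.of_apply, hv' _ l rfl]
        -- Entries to the left of a pivot vanish because `A` is zero off the diagram.
        exact (hC w hw).2 A hA i l hj.not_gt
    · simp [hv _ i rfl, hi]
  refine ⟨rowSpace (Matrix.of fun i j => v j i), w, hw, hM.fullOn.finrank_rowSpace, p, _, hM, rfl,
    A, hA, ?_⟩
  funext i l
  have h : (i, l) ∈ ferrersDiagram w (hS w hw) ↔ p i < nonPivots p l := Iff.rfl
  simp only [tableau, portion, h, Matrix.of_apply, hv' _ l rfl]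

theorem finrank_of_mem_multilevel {X : Submodule F (Fin n → F)} (hX : X ∈ multilevel S hS C) :
    Module.finrank F ↥X = k := by
  obtain ⟨w, hw, hX⟩ := hX
  exact hX.1

theorem ncard_union_eq_of_dist [Finite F] {d : ℕ} (hd : 0 < d) {X Y : Set (Submodule F (Fin n → F))}
    (h : ∀ U ∈ X, ∀ V ∈ Y, d ≤ subspaceDist U V) : (X ∪ Y).ncard = X.ncard + Y.ncard := by
  refine Set.ncard_union_eq (Set.disjoint_left.2 fun U hX hY => ?_)
  have := h U hX U hY
  rw [subspaceDist_self] at this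
  omega

end Multilevel

end SubspaceCodes

/-! ### Assembling the pairwise distance bounds. -/

theorem theorem6 {F : Type*} [Field F] [Fintype F] (n₁ n₂ k δ : ℕ)
    (hkn₁ : k ≤ n₁) (hkn₂ : k ≤ n₂) (hδ : 2 ≤ δ) (hδk : δ ≤ k)
    -- the data of the mixed dimension construction
    (T₁ T₂ : Finset ℕ) (hT₁ne : T₁.Nonempty) (hT₂ne : T₂.Nonempty)
    (hT₁ : T₁ ⊆ Finset.Icc δ k) (hlT₁ : minGap T₁ < 2 * δ)
    (hT₂ : T₂ ⊆ Finset.Icc (k + δ - T₁.min' hT₁ne) k) (hlT₂ : minGap T₂ < 2 * δ)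
    (X₁ : Set (Submodule F (Fin n₁ → F))) (X₂ : Set (Submodule F (Fin n₂ → F)))
    (hX₁ : IsMDDC (2 * δ) (2 * δ - minGap T₁) T₁ X₁)
    (hX₂ : IsMDDC (2 * δ) (2 * δ - minGap T₂) T₂ X₂)
    (H₁ : (r : ℕ) → Set (Matrix (Fin r) (Fin n₁) F))
    (H₂ : (r : ℕ) → Set (Matrix (Fin r) (Fin n₂) F))
    (hH₁ : IsRREFSCRep T₁ H₁ X₁) (hH₂ : IsRREFSCRep T₂ H₂ X₂)
    (P : (t : ℕ) → Set (Matrix (Fin k) (Fin (n₂ + t - k)) F))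
    (hP : ∀ t ∈ T₁, IsMRD δ (P t))
    (Q : (s : ℕ) → Set (Matrix (Fin k) (Fin (n₁ + s - k)) F))
    (hQ : ∀ s ∈ T₂, IsRRMC δ (T₁.min' hT₁ne - δ - (k - s)) (Q s))
    -- the identifying vectors
    (S : Set (Fin (n₁ + n₂) → ZMod 2))
    (hSk : ∀ w ∈ S, hammingNorm w = k)
    (hSleft : ∀ w ∈ S, δ ≤ segWeight w 0 (n₁ + T₂.min' hT₂ne - k))
    (hSright : ∀ w ∈ S, δ ≤ segWeight w (n₁ + k - T₁.min' hT₁ne) (n₁ + n₂))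
    (hSdist : ∀ w ∈ S, ∀ w' ∈ S, w ≠ w' → 2 * δ ≤ hammingDist w w')
    -- the rank-restricted Ferrers diagram rank-metric codes
    (CF : (Fin (n₁ + n₂) → ZMod 2) → Set (Matrix (Fin k) (Fin (n₁ + n₂ - k)) F))
    (hCF : ∀ (w : Fin (n₁ + n₂) → ZMod 2) (hw : w ∈ S),
      IsRFDRMC (ferrersDiagram w (hSk w hw)) δ
        (segWeight w 0 (n₁ + T₂.min' hT₂ne - k))
        (n₂ - T₂.min' hT₂ne + segWeight w 0 (n₁ + T₂.min' hT₂ne - k))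
        (segWeight w 0 (n₁ + T₂.min' hT₂ne - k) - δ) (CF w)) :
    ((∃ w ∈ S, (CF w).Nonempty) → IsCDC (2 * δ) k (multilevel S hSk CF)) ∧
    IsCDC (2 * δ) k
      (mixedLeft k n₁ n₂ T₁ H₁ P ∪ mixedRight k n₁ n₂ T₂ H₂ Q ∪ multilevel S hSk CF) ∧
    (mixedLeft k n₁ n₂ T₁ H₁ P ∪ mixedRight k n₁ n₂ T₂ H₂ Q ∪ multilevel S hSk CF).ncard =
      (mixedLeft k n₁ n₂ T₁ H₁ P).ncard + (mixedRight k n₁ n₂ T₂ H₂ Q).ncard +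
        (multilevel S hSk CF).ncard := by 
  have hC w hw := (hCF w hw).1
  have hT₁k : ∀ t ∈ T₁, t ≤ k := fun t ht => (Finset.mem_Icc.1 (hT₁ ht)).2
  have hT₂k : ∀ s ∈ T₂, s ≤ k := fun s hs => (Finset.mem_Icc.1 (hT₂ hs)).2
  have hmin₁ : ∀ t ∈ T₁, T₁.min' hT₁ne ≤ t := fun t ht => T₁.min'_le t ht
  have hmin₂ : ∀ s ∈ T₂, T₂.min' hT₂ne ≤ s := fun s hs => T₂.min'_le s hs
  have hdL : ∀ U ∈ mixedLeft k n₁ n₂ T₁ H₁ P, Module.finrank F ↥U = k := by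
    rintro _ ⟨t, ht, A, hA, B, hB, rfl⟩
    exact (fullOn_blockLeft (hT₁k t ht) hkn₂ (hH₁.rank_eq t ht A hA) B).finrank_rowSpace
  have hdR : ∀ U ∈ mixedRight k n₁ n₂ T₂ H₂ Q, Module.finrank F ↥U = k := by
    rintro _ ⟨s, hs, B, hB, A, hA, rfl⟩
    exact (fullOn_blockRight (hT₂k s hs) hkn₁ B (hH₂.rank_eq s hs A hA)).finrank_rowSpace
  have hLL : ∀ U ∈ mixedLeft k n₁ n₂ T₁ H₁ P, ∀ V ∈ mixedLeft k n₁ n₂ T₁ H₁ P, U ≠ V →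
      2 * δ ≤ subspaceDist U V := fun U hU V hV =>
    two_mul_le_subspaceDist_blockLeft hkn₂ hT₁k hX₁ hH₁ (fun t ht => (hP t ht).1) hU hV
  have hRR : ∀ U ∈ mixedRight k n₁ n₂ T₂ H₂ Q, ∀ V ∈ mixedRight k n₁ n₂ T₂ H₂ Q, U ≠ V →
      2 * δ ≤ subspaceDist U V := fun U hU V hV =>
    two_mul_le_subspaceDist_blockRight hkn₁ hT₂k hX₂ hH₂ (fun s hs => (hQ s hs).1) hU hV
  have hMM : ∀ U ∈ multilevel S hSk CF, ∀ V ∈ multilevel S hSk CF, U ≠ V →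
      2 * δ ≤ subspaceDist U V := fun U hU V hV =>
    two_mul_le_subspaceDist_multilevel hSdist hC hU hV
  have hLR : ∀ U ∈ mixedLeft k n₁ n₂ T₁ H₁ P, ∀ V ∈ mixedRight k n₁ n₂ T₂ H₂ Q,
      2 * δ ≤ subspaceDist U V := by
    rintro _ ⟨t, ht, A, hA, B, hB, rfl⟩ _ ⟨s, hs, B', hB', A', hA', rfl⟩
    have h := (Finset.mem_Icc.1 (hT₂ hs)).1
    exact two_mul_le_subspaceDist_blockLeft_blockRight hkn₁ hkn₂ (hmin₁ t ht) (hT₁k t ht)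
      (by omega) (hT₂k s hs) (hH₁.rank_eq t ht A hA) B ((hQ s hs).2 B' hB')
      (hH₂.rank_eq s hs A' hA')
  have hLM : ∀ U ∈ mixedLeft k n₁ n₂ T₁ H₁ P, ∀ V ∈ multilevel S hSk CF,
      2 * δ ≤ subspaceDist U V := by
    rintro _ ⟨t, ht, A, hA, B, hB, rfl⟩ V hV
    obtain ⟨w, hw, M, A', hA', hM, rfl⟩ := exists_isLift_of_mem_multilevel hC hV
    refine two_mul_le_subspaceDist_blockLeft_lift hkn₂ (hmin₁ t ht) (hT₁k t ht)
      (hH₁.rank_eq t ht A hA) B hM.1 ?_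
    have h := hSright w hw
    rw [segWeight_eq_card w (hSk w hw)] at h
    -- The upper end `n₁ + n₂` of the segment excludes no column.
    simpa only [Fin.is_lt, and_true] using h
  have hRM : ∀ U ∈ mixedRight k n₁ n₂ T₂ H₂ Q, ∀ V ∈ multilevel S hSk CF,
      2 * δ ≤ subspaceDist U V := by
    rintro _ ⟨s, hs, B, hB, A, hA, rfl⟩ V hV
    obtain ⟨w, hw, M, A', hA', hM, rfl⟩ := exists_isLift_of_mem_multilevel hC hV
    have h := segWeight_eq_card w (hSk w hw) 0 (n₁ + T₂.min' hT₂ne - k)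
    simp only [zero_le, true_and] at h
    exact two_mul_le_subspaceDist_blockRight_lift hkn₁ hkn₂ (hmin₂ s hs) (hT₂k s hs) B
      (hH₂.rank_eq s hs A hA) hM h (hSleft w hw) ((hCF w hw).2 A' hA')
  refine ⟨?_, isCDC_of_forall ?_ ?_ ?_, ?_⟩
  · rintro ⟨w, hw, hne⟩
    exact isCDC_of_forall (multilevel_nonempty hC hw hne)
      (fun U hU => finrank_of_mem_multilevel hU) hMM
  -- `C₁` alone is non-empty, so the union needs no assumption that some `CF w` is.
  · obtain ⟨t, ht⟩ := hT₁ne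
    obtain ⟨A, hA⟩ := hH₁.nonempty ht ((hX₁.eta_pos_iff t).2 ht)
    obtain ⟨B, hB⟩ := (hP t ht).nonempty
    exact ⟨_, Or.inl (Or.inl ⟨t, ht, A, hA, B, hB, rfl⟩)⟩
  · rintro U ((hU | hU) | hU)
    · exact hdL U hU
    · exact hdR U hU
    · exact finrank_of_mem_multilevel hU
  · rintro U ((hU | hU) | hU) V ((hV | hV) | hV) hUV
    · exact hLL U hU V hV hUV
    · exact hLR U hU V hV
    · exact hLM U hU V hV
    · exact subspaceDist_comm V U ▸ hLR V hV U hU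
    · exact hRR U hU V hV hUV
    · exact hRM U hU V hV
    · exact subspaceDist_comm V U ▸ hLM V hV U hU
    · exact subspaceDist_comm V U ▸ hRM V hV U hU
    · exact hMM U hU V hV hUV
  · rw [ncard_union_eq_of_dist (d := 2 * δ) (by omega), ncard_union_eq_of_dist (by omega) hLR]
    rintro U (hU | hU) V hV
    · exact hLM U hU V hV
    · exact hRM U hU V hV
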